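/- Let $n,q\ge 1$ be integers, $t_0<t_f$ real, $h=t_f-t_0$, and let $\mathbf t=[t_1,\dots,t_n]^T$ be a vector of pairwise distinct real points (not necessarily in $[t_0,t_f]$). Powers $\mathbf t^j$ are taken componentwise and $\mathbb 1=[1,\dots,1]^T$. A (diagonal-norm) generalized summation-by-parts (GSBP) operator of order $q$ is a matrix $D=H^{-1}\Theta$ with $H,\Theta\in\mathbb R^{n\times n}$, $H$ (diagonal and) symmetric positive definite, such that $D\mathbf t^j=j\,\mathbf t^{j-1}$ for $0\le j\le q$, and for some $r\ge q$, $(\mathbf t^i)^T(\Theta+\Theta^T)\mathbf t^j=t_f^{i+j}-t_0^{i+j}$ for $0\le i,j\le r$. Suppose that moreover: (i) there are $\chi_0,\chi_f\in\mathbb R^n$ with $\Theta+\Theta^T=\chi_f\chi_f^T-\chi_0\chi_0^T$ and, for some $r\ge q$, $\chi_0^T\mathbf t^j=t_0^j$ and $\chi_f^T\mathbf t^j=t_f^j$ for $0\le j\le r$; (ii) the matrix $\Theta+\chi_0\chi_0^T$ is invertible; (iii) $H$ is diagonal, and the quadrature rule with nodes $\mathbf t$ and weights $\mathbf w=H\mathbb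 1$ has order $\tau\in\mathbb{N}$ on $[t_0,t_f]$, i.e. $\sum_i w_iP(t_i)=\int_{t_0}^{t_f}P(x)\,dx$ for all real polynomials $P$ of degree at most $\tau-1$. Then the $n$-stage implicit Runge–Kutta method with coefficients $$A=\tfrac1h(\Theta+\chi_0\chi_0^T)^{-1}H,\qquad b=\tfrac1hH\mathbb 1,\qquad \mathbf c=\tfrac1h(\mathbf t-t_0\mathbb 1)$$ has classical (nonlinear) order at least $p=\min(\tau,2q+1)$. Here a Runge–Kutta method $(A,b,\mathbf c)$ has classical order at least $p$ if the following holds for every finite-dimensional real normed space $E$, every $s\in\mathbb R$, every $f:\mathbb R\times E\to E$, and every solution $y$ of $y'(t)=f(t,y(t))$ on some interval $[s,s+\delta]$, $\delta>0$, such that $f$ is of class $C^{p+1}$ in a neighbourhood of $(s,y(s))$: there are $r,h_0>0$ and $C$ such that for every step size $0<k\le h_0$ the stage equations $$Y_i=y(s)+k\sum_{j=1}^nA_{ij}f(s+c_jk,Y_j),\qquad i=1,\dots,n,$$ have exactly one solution with all $\|Y_i-y(s)\|\le r$, and for this solution $$\Big\|y(s)+k\sum_{j=1}^nb_jf(s+c_jk,Y_j)-y(s+k)\Big\|\le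 C\,k^{p+1}.$$ -/

import Mathlib

open scoped Matrix

noncomputable section

/-- A generalized summation-by-parts (GSBP) operator `D = H⁻¹ Θ` approximating the first
derivative to order `q ≥ 1` on the pairwise distinct points `t 0, …, t (n - 1)`, for the time
step `[t₀, t₁]`.  Powers of vectors are componentwise. -/
structure GSBPOperator (n q : ℕ) where
  t₀ : ℝ
  t₁ : ℝ
  t₀_lt_t₁ : t₀ < t₁
  one_le_q : 1 ≤ q
  t : Fin n → ℝ
  t_injective : Function.Injective t
  H : Matrix (Fin n) (Fin n) ℝ
  Θ : Matrix (Fin n) (Fin n) ℝ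
  H_posDef : H.PosDef
  D_pow : ∀ j : ℕ, j ≤ q → (H⁻¹ * Θ) *ᵥ (t ^ j) = (j : ℝ) • t ^ (j - 1)
  boundary : ∃ r : ℕ, q ≤ r ∧ ∀ i j : ℕ, i ≤ r → j ≤ r →
    (t ^ i) ⬝ᵥ ((Θ + Θᵀ) *ᵥ (t ^ j)) = t₁ ^ (i + j) - t₀ ^ (i + j)

namespace GSBPOperator

variable {n q : ℕ}

/-- The vectors `χ₀`, `χ₁` factor the boundary operator as `Θ + Θᵀ = χ₁ χ₁ᵀ - χ₀ χ₀ᵀ`, and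
they extrapolate monomials of degree at most some `r ≥ q` exactly to the end points. -/
def IsSATCompatible (G : GSBPOperator n q) (χ₀ χ₁ : Fin n → ℝ) : Prop :=
  G.Θ + G.Θᵀ = Matrix.vecMulVec χ₁ χ₁ - Matrix.vecMulVec χ₀ χ₀ ∧
  ∃ r : ℕ, q ≤ r ∧ ∀ j : ℕ, j ≤ r →
    χ₀ ⬝ᵥ (G.t ^ j) = G.t₀ ^ j ∧ χ₁ ⬝ᵥ (G.t ^ j) = G.t₁ ^ j

/-- The weights `H 𝟙` on the points `t` form a quadrature rule of order `τ` on `[t₀, t₁]`: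
polynomials of degree at most `τ - 1` are integrated exactly. -/
def HasQuadratureOrder (G : GSBPOperator n q) (τ : ℕ) : Prop :=
  ∀ P : Polynomial ℝ, P.degree < (τ : WithBot ℕ) →
    (G.H *ᵥ (1 : Fin n → ℝ)) ⬝ᵥ (fun i => P.eval (G.t i)) = ∫ x in G.t₀..G.t₁, P.eval x

/-- The matrix `Θ + χ₀ χ₀ᵀ` of the dual-consistent (`σ = -1`) discretization. -/
def stepMatrix (G : GSBPOperator n q) (χ₀ : Fin n → ℝ) : Matrix (Fin n) (Fin n) ℝ :=
  G.Θ + Matrix.vecMulVec χ₀ χ₀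

end GSBPOperator

/-- An `n`-stage (in general implicit) Runge–Kutta method. -/
structure RungeKutta (n : ℕ) where
  A : Matrix (Fin n) (Fin n) ℝ
  b : Fin n → ℝ
  c : Fin n → ℝ

namespace RungeKutta

variable {n : ℕ} {E : Type} [NormedAddCommGroup E] [NormedSpace ℝ E]

/-- `Y` solves the stage equations for one step of size `h` from `(s, y₀)` applied to
`y' = f t y`. -/
def IsStages (M : RungeKutta n) (f : ℝ → E → E) (s : ℝ) (y₀ : E) (h : ℝ) (Y : Fin n → E) :
    Prop :=
  ∀ k, Y k = y₀ + h • ∑ j, M.A k j • f (s + M.c j * h) (Y j)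

/-- The value after one step of size `h` from `(s, y₀)`, computed from the stages `Y`. -/
def update (M : RungeKutta n) (f : ℝ → E → E) (s : ℝ) (y₀ : E) (h : ℝ) (Y : Fin n → E) : E :=
  y₀ + h • ∑ j, M.b j • f (s + M.c j * h) (Y j)

/-- Classical order (at least) `p`: for every finite-dimensional nonlinear system `y' = f t y`
whose right-hand side is of class `C^(p+1)` near the initial point, and every solution `y` on an
interval `[s, s + δ]`, the stage equations have, for all small step sizes `h > 0`, exactly one
solution in a fixed ball about the initial value, and the error of one step computed from it
is `O(h^(p+1))`. -/
def HasOrder (M : RungeKutta n) (p : ℕ) : Prop :=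
  ∀ (E : Type) [NormedAddCommGroup E] [NormedSpace ℝ E] [FiniteDimensional ℝ E]
    (f : ℝ → E → E) (s : ℝ) (y : ℝ → E) (δ : ℝ),
    ContDiffAt ℝ ((p + 1 : ℕ) : WithTop ℕ∞) (fun z : ℝ × E => f z.1 z.2) (s, y s) →
    0 < δ →
    (∀ t ∈ Set.Icc s (s + δ), HasDerivWithinAt y (f t (y t)) (Set.Icc s (s + δ)) t) →
    ∃ r > 0, ∃ h₀ > 0, ∃ C : ℝ, ∀ h : ℝ, 0 < h → h ≤ h₀ →
      (∃! Y : Fin n → E, (∀ k, Y k ∈ Metric.closedBall (y s) r) ∧ M.IsStages f s (y s) h Y) ∧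
      ∀ Y : Fin n → E, (∀ k, Y k ∈ Metric.closedBall (y s) r) → M.IsStages f s (y s) h Y →
        ‖M.update f s (y s) h Y - y (s + h)‖ ≤ C * h ^ (p + 1)

end RungeKutta

/-- The Runge–Kutta method of a GSBP time-marching method, with `h = t₁ - t₀`:
`A = h⁻¹ (Θ + χ₀ χ₀ᵀ)⁻¹ H`, `b = h⁻¹ H 𝟙`, `c = h⁻¹ (t - t₀ 𝟙)`. -/
def GSBPOperator.toRungeKutta {n q : ℕ} (G : GSBPOperator n q) (χ₀ : Fin n → ℝ) :
    RungeKutta n where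
  A := (G.t₁ - G.t₀)⁻¹ • ((G.stepMatrix χ₀)⁻¹ * G.H)
  b := (G.t₁ - G.t₀)⁻¹ • (G.H *ᵥ (1 : Fin n → ℝ))
  c := fun i => (G.t i - G.t₀) / (G.t₁ - G.t₀)

end

/-!
The coefficients of the method satisfy Butcher's simplifying assumptions `B(τ)`, `C(q)` and `D(q)`,
and these imply order `min τ (2 q + 1)`.

Exactness of the operator on polynomials of degree at most `q` reads
`(Θ + χ₀ χ₀ᵀ) P(t) = H P'(t) + P(t₀) χ₀`, and solving for `P(t)` with `P = ((x - t₀) / h) ^ m` gives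
`C(q)` (`IsSATCompatible.stageCondition`). The summation-by-parts property turns the transposed step
matrix into `χ₁ χ₁ᵀ - Θ`, and the same argument from the other end point gives `D(q)`
(`IsSATCompatible.adjointCondition`).

The order is proved without rooted trees, by a duality argument (`RungeKutta.local_error_isBigO`).
By `C(q)` the stage errors `E` are `O(h ^ (q + 1))`. Up to terms of order `h ^ (p + 1)`, the local
error is the quadrature error of the exact solution plus the linear functional `h ∑ b_j J_j E_j`,
where `J` is the Jacobian along the solution. A solution `U` of the adjoint equation `U' = -U J`
satisfies a discrete version of the adjoint equation by `D(q)`, with a defect `O(h ^ (q + 1))`.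
Pairing it with the equation for `E` (`weighted_linearized_error_eq`) replaces `E` by the residuals
of the exact solution in the stage equations. By `C(q)` these are also the residuals of the Taylor
remainder `z` of degree `q`, and what is left over is the quadrature, by `B(p)`, of `(U z)'` and
`z'`: the exact integrals cancel. The remaining terms are nonlinear remainders of
order `h ^ (p + 2)` and products of two small quantities whose orders, with the factor `h`, add up to
at least `2 q + 2`.

Stages exist uniquely near the initial value by contraction (`exists_existsUnique_stages`), and
nonautonomous systems reduce to autonomous ones because `C(1)` makes the stages of `t' = 1` equal
to the nodes (`RungeKutta.hasOrder_of_simplifyingConditions`).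
-/

/-! ### The simplifying assumptions for GSBP methods -/

/-- Butcher's simplifying assumption `B(p)`: the quadrature rule on `[0, 1]` with weights `b` and
nodes `c` is exact for polynomials of degree less than `p`. -/
def RungeKutta.QuadratureCondition {n : ℕ} (M : RungeKutta n) (p : ℕ) : Prop :=
  ∀ m < p, ∑ j, M.b j * M.c j ^ m = 1 / ((m : ℝ) + 1)

/-- Butcher's simplifying assumption `C(q)`: each stage integrates polynomials of degree less than
`q` exactly from `0` to its node. -/
def RungeKutta.StageCondition {n : ℕ} (M : RungeKutta n) (q : ℕ) : Prop :=
  ∀ m < q, ∀ k, ∑ j, M.A k j * M.c j ^ m = M.c k ^ (m + 1) / ((m : ℝ) + 1)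

/-- Butcher's simplifying assumption `D(q)`: the transposed method, with weights
`b i * A i j / b j`, integrates polynomials of degree less than `q` exactly from the node `c j` to `1`. -/
def RungeKutta.AdjointCondition {n : ℕ} (M : RungeKutta n) (q : ℕ) : Prop :=
  ∀ m < q, ∀ j, ∑ i, M.b i * M.A i j * M.c i ^ m =
    M.b j * (1 - M.c j ^ (m + 1)) / ((m : ℝ) + 1)

namespace GSBPOperator

variable {n q : ℕ} (G : GSBPOperator n q)

lemma Θ_mulVec_eval {P : Polynomial ℝ} (hP : P.natDegree ≤ q) :
    G.Θ *ᵥ (fun i => P.eval (G.t i)) = G.H *ᵥ (fun i => P.derivative.eval (G.t i)) := by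
  have hH : IsUnit G.H.det := (Matrix.isUnit_iff_isUnit_det _).1 G.H_posDef.isUnit
  have key : (G.H⁻¹ * G.Θ) *ᵥ (fun i => P.eval (G.t i)) =
      fun i => P.derivative.eval (G.t i) := by
    have h1 : (fun i => P.eval (G.t i)) =
        ∑ j ∈ Finset.range (q + 1), P.coeff j • G.t ^ j := by
      ext i
      rw [Polynomial.eval_eq_sum_range' (Nat.lt_succ_of_le hP)]
      simp [Finset.sum_apply]
    have h2 : (fun i => P.derivative.eval (G.t i)) =
        ∑ j ∈ Finset.range (q + 1), P.coeff j • ((j : ℝ) • G.t ^ (j - 1)) := by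
      ext i
      rw [Polynomial.derivative_eval, Polynomial.sum_over_range' _ _ _ (Nat.lt_succ_of_le hP)]
      · simp [Finset.sum_apply, mul_assoc]
      · simp
    rw [h1, h2, Matrix.mulVec_sum]
    refine Finset.sum_congr rfl fun j hj => ?_
    rw [Matrix.mulVec_smul, G.D_pow j (Nat.lt_succ_iff.1 (Finset.mem_range.1 hj))]
  rw [← key, Matrix.mulVec_mulVec, Matrix.mul_nonsing_inv_cancel_left _ _ hH]

variable {G} {χ₀ χ₁ : Fin n → ℝ}

lemma IsSATCompatible.dotProduct_eval (hχ : G.IsSATCompatible χ₀ χ₁)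
    {P : Polynomial ℝ} (hP : P.natDegree ≤ q) :
    χ₀ ⬝ᵥ (fun i => P.eval (G.t i)) = P.eval G.t₀ ∧
      χ₁ ⬝ᵥ (fun i => P.eval (G.t i)) = P.eval G.t₁ := by
  obtain ⟨r, hr, h⟩ := hχ.2
  have h1 : (fun i => P.eval (G.t i)) =
      ∑ j ∈ Finset.range (q + 1), P.coeff j • G.t ^ j := by
    ext i
    rw [Polynomial.eval_eq_sum_range' (Nat.lt_succ_of_le hP)]
    simp [Finset.sum_apply]
  rw [h1, dotProduct_sum, dotProduct_sum, Polynomial.eval_eq_sum_range' (Nat.lt_succ_of_le hP),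
    Polynomial.eval_eq_sum_range' (Nat.lt_succ_of_le hP)]
  constructor <;>
  · refine Finset.sum_congr rfl fun j hj => ?_
    have := h j ((Nat.lt_succ_iff.1 (Finset.mem_range.1 hj)).trans hr)
    simp [dotProduct_smul, this]

lemma IsSATCompatible.stepMatrix_mulVec_eval (hχ : G.IsSATCompatible χ₀ χ₁)
    {P : Polynomial ℝ} (hP : P.natDegree ≤ q) :
    G.stepMatrix χ₀ *ᵥ (fun i => P.eval (G.t i)) =
      G.H *ᵥ (fun i => P.derivative.eval (G.t i)) + P.eval G.t₀ • χ₀ := by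
  rw [stepMatrix, Matrix.add_mulVec, G.Θ_mulVec_eval hP, Matrix.vecMulVec_mulVec,
    (hχ.dotProduct_eval hP).1]
  simp

/-- The boundary factorization turns the transpose of the step matrix into `χ₁ χ₁ᵀ - Θ`, the step
matrix of the problem integrated backwards from `t₁`. -/
lemma IsSATCompatible.stepMatrix_transpose_mulVec_eval (hχ : G.IsSATCompatible χ₀ χ₁)
    {P : Polynomial ℝ} (hP : P.natDegree ≤ q) :
    (G.stepMatrix χ₀)ᵀ *ᵥ (fun i => P.eval (G.t i)) =
      P.eval G.t₁ • χ₁ - G.H *ᵥ (fun i => P.derivative.eval (G.t i)) := by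
  have h : (G.stepMatrix χ₀)ᵀ = Matrix.vecMulVec χ₁ χ₁ - G.Θ := by
    rw [stepMatrix, Matrix.transpose_add, Matrix.transpose_vecMulVec, eq_sub_iff_add_eq]
    have := hχ.1
    rw [eq_sub_iff_add_eq] at this
    rw [← this]; abel
  rw [h, Matrix.sub_mulVec, G.Θ_mulVec_eval hP, Matrix.vecMulVec_mulVec,
    (hχ.dotProduct_eval hP).2]
  simp

variable (G) in
/-- The monomial `((x - t₀) / h) ^ m`, whose values on the points are the powers of the
abscissae. -/
noncomputable def stepMonomial (m : ℕ) : Polynomial ℝ :=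
  (Polynomial.C (G.t₁ - G.t₀)⁻¹ * (Polynomial.X - Polynomial.C G.t₀)) ^ m

variable (G) in
lemma stepMonomial_eval (m : ℕ) (x : ℝ) :
    (G.stepMonomial m).eval x = ((x - G.t₀) / (G.t₁ - G.t₀)) ^ m := by
  simp [stepMonomial, div_eq_inv_mul]

variable (G) in
lemma stepMonomial_natDegree_le (m : ℕ) : (G.stepMonomial m).natDegree ≤ m := by
  refine Polynomial.natDegree_pow_le.trans ?_
  have : (Polynomial.C (G.t₁ - G.t₀)⁻¹ * (Polynomial.X - Polynomial.C G.t₀)).natDegree ≤ 1 :=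
    (Polynomial.natDegree_C_mul_le _ _).trans (Polynomial.natDegree_X_sub_C_le _)
  nlinarith

variable (G) in
lemma stepMonomial_derivative_eval (m : ℕ) (x : ℝ) :
    (G.stepMonomial (m + 1)).derivative.eval x =
      ((m : ℝ) + 1) * (G.t₁ - G.t₀)⁻¹ * ((x - G.t₀) / (G.t₁ - G.t₀)) ^ m := by
  simp [stepMonomial, Polynomial.derivative_pow, div_eq_inv_mul]
  ring

variable (G) in
lemma step_ne_zero : G.t₁ - G.t₀ ≠ 0 := (sub_pos.2 G.t₀_lt_t₁).ne'

lemma IsSATCompatible.stageCondition (hχ : G.IsSATCompatible χ₀ χ₁)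
    (hinv : IsUnit (G.stepMatrix χ₀)) : (G.toRungeKutta χ₀).StageCondition q := by
  intro m hm k
  have hS := (Matrix.isUnit_iff_isUnit_det _).1 hinv
  have h := hχ.stepMatrix_mulVec_eval ((G.stepMonomial_natDegree_le (m + 1)).trans hm)
  simp only [stepMonomial_eval, stepMonomial_derivative_eval, sub_self, zero_div, ne_eq,
    Nat.succ_ne_zero, not_false_eq_true, zero_pow, zero_smul, add_zero] at h
  have h2 := congrArg (fun v => ((G.stepMatrix χ₀)⁻¹ *ᵥ v) k) h
  simp only [Matrix.mulVec_mulVec, Matrix.nonsing_inv_mul _ hS, Matrix.one_mulVec] at h2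
  have hm1 : (m : ℝ) + 1 ≠ 0 := by positivity
  rw [eq_div_iff hm1]
  change (∑ j, _ * _) * _ = ((G.t k - G.t₀) / (G.t₁ - G.t₀)) ^ (m + 1)
  rw [h2, Matrix.mulVec, dotProduct, Finset.sum_mul]
  refine Finset.sum_congr rfl fun j _ => ?_
  simp only [toRungeKutta, Matrix.smul_apply, smul_eq_mul]
  ring

lemma b_toRungeKutta (hdiag : G.H.IsDiag) (j : Fin n) :
    (G.toRungeKutta χ₀).b j = (G.t₁ - G.t₀)⁻¹ * G.H j j := by
  simp only [toRungeKutta, Pi.smul_apply, smul_eq_mul, Matrix.mulVec, dotProduct, Pi.one_apply,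
    mul_one]
  rw [Finset.sum_eq_single j (fun i _ hi => hdiag hi.symm) (by simp)]

lemma IsSATCompatible.adjointCondition (hχ : G.IsSATCompatible χ₀ χ₁)
    (hinv : IsUnit (G.stepMatrix χ₀)) (hdiag : G.H.IsDiag) :
    (G.toRungeKutta χ₀).AdjointCondition q := by
  intro m hm j
  have hS := (Matrix.isUnit_iff_isUnit_det _).1 hinv
  have hm1 : (m : ℝ) + 1 ≠ 0 := by positivity
  -- `1 - c ^ (m + 1)` vanishes at the end point, so that `χ₁` drops out of the transposed identity
  set u : Fin n → ℝ := fun i => 1 - (G.toRungeKutta χ₀).c i ^ (m + 1) with hu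
  have h := hχ.stepMatrix_transpose_mulVec_eval (P := 1 - G.stepMonomial (m + 1))
    ((Polynomial.natDegree_sub_le _ _).trans
      (by simpa using (G.stepMonomial_natDegree_le (m + 1)).trans hm))
  simp only [Polynomial.eval_sub, Polynomial.eval_one, stepMonomial_eval,
    div_self G.step_ne_zero, one_pow, sub_self, zero_smul, zero_sub, Polynomial.derivative_sub,
    Polynomial.derivative_one, Polynomial.eval_neg, stepMonomial_derivative_eval] at h
  have hv : (fun i => ((m : ℝ) + 1) * ((G.toRungeKutta χ₀).b i *
      (G.toRungeKutta χ₀).c i ^ m)) = u ᵥ* G.stepMatrix χ₀ := by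
    rw [← Matrix.mulVec_transpose]
    refine Eq.trans ?_ h.symm
    ext i
    rw [b_toRungeKutta hdiag, ← Matrix.mulVec_neg, Matrix.mulVec, dotProduct,
      Finset.sum_eq_single i (fun k _ hk => by rw [hdiag hk.symm, zero_mul]) (by simp)]
    simp only [toRungeKutta, Pi.neg_apply, neg_neg]
    ring
  have h2 : (u ᵥ* G.stepMatrix χ₀) ᵥ* (G.toRungeKutta χ₀).A =
      (G.t₁ - G.t₀)⁻¹ • (u ᵥ* G.H) := by
    simp only [toRungeKutta]
    rw [Matrix.vecMul_smul, Matrix.vecMul_vecMul, Matrix.mul_nonsing_inv_cancel_left _ _ hS]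
  have h3 := congrFun h2 j
  rw [← hv] at h3
  simp only [Matrix.vecMul, dotProduct, Pi.smul_apply, smul_eq_mul] at h3
  rw [Finset.sum_eq_single (f := fun i => u i * G.H i j) j
    (fun k _ hk => by rw [hdiag hk, mul_zero]) (by simp)] at h3
  rw [eq_div_iff hm1, b_toRungeKutta hdiag, Finset.sum_mul]
  rw [show (G.t₁ - G.t₀)⁻¹ * G.H j j * (1 - (G.toRungeKutta χ₀).c j ^ (m + 1)) =
    (G.t₁ - G.t₀)⁻¹ * (u j * G.H j j) by simp only [hu]; ring, ← h3]
  exact Finset.sum_congr rfl fun i _ => by ring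

lemma HasQuadratureOrder.quadratureCondition {τ : ℕ} (hτ : G.HasQuadratureOrder τ) :
    (G.toRungeKutta χ₀).QuadratureCondition τ := by
  intro m hm
  have h0 := G.step_ne_zero
  have h := hτ (G.stepMonomial m) ((Polynomial.degree_le_of_natDegree_le
    (G.stepMonomial_natDegree_le m)).trans_lt (by exact_mod_cast hm))
  simp only [stepMonomial_eval] at h
  have hint : ∫ x in G.t₀..G.t₁, ((x - G.t₀) / (G.t₁ - G.t₀)) ^ m =
      (G.t₁ - G.t₀) / ((m : ℝ) + 1) := by
    simp_rw [div_pow]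
    rw [intervalIntegral.integral_div,
      intervalIntegral.integral_comp_sub_right (fun x => x ^ m) G.t₀, integral_pow]
    have hm1 : (m : ℝ) + 1 ≠ 0 := by positivity
    field_simp
    simp
    ring
  rw [hint] at h
  rw [one_div, ← mul_right_inj' h0, ← div_eq_mul_inv, ← h, Finset.mul_sum, dotProduct]
  refine Finset.sum_congr rfl fun j _ => ?_
  simp only [toRungeKutta, Pi.smul_apply, smul_eq_mul]
  field_simp

end GSBPOperator

section Analysis

open Filter Topology Asymptotics Metric

variable {X : Type*} [NormedAddCommGroup X] [NormedSpace ℝ X] {n : ℕ} {s : ℝ} {k : ℕ}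

/-! ### Taylor expansion of curves -/

/-- Integration raises the order of vanishing at `s` by one: a mean value estimate on the interval
between `s` and `t`. -/
lemma isBigO_sub_pow_of_deriv {φ : ℝ → X} (hφ : ∀ᶠ t in 𝓝 s, DifferentiableAt ℝ φ t)
    (h0 : φ s = 0) (h' : deriv φ =O[𝓝 s] fun t => (t - s) ^ k) :
    φ =O[𝓝 s] fun t => (t - s) ^ (k + 1) := by
  obtain ⟨C, hC0, hC⟩ := h'.exists_nonneg
  obtain ⟨ε, hε, hb⟩ := Metric.eventually_nhds_iff_ball.1 (hφ.and hC.bound)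
  refine IsBigO.of_bound C ?_
  filter_upwards [ball_mem_nhds s hε] with t ht
  have hsub : closedBall s |t - s| ⊆ ball s ε := closedBall_subset_ball (by
    simpa [Real.dist_eq] using ht)
  have hbound : ∀ x ∈ closedBall s |t - s|, ‖deriv φ x‖ ≤ C * |t - s| ^ k := by
    intro x hx
    refine (hb x (hsub hx)).2.trans ?_
    rw [norm_pow, Real.norm_eq_abs]
    rw [mem_closedBall, Real.dist_eq] at hx
    gcongr
  have := (convex_closedBall s |t - s|).norm_image_sub_le_of_norm_deriv_le
    (fun x hx => (hb x (hsub hx)).1) hbound (mem_closedBall_self (abs_nonneg _))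
    (y := t) (by simp [Real.dist_eq])
  rw [h0, sub_zero, Real.norm_eq_abs, mul_assoc, ← pow_succ] at this
  simpa [norm_pow, Real.norm_eq_abs] using this

/-- The polynomial `∑ i < k, (t - s) ^ i • a i` centred at `s`. -/
def centredPoly (s : ℝ) (a : ℕ → X) (k : ℕ) (t : ℝ) : X :=
  ∑ i ∈ Finset.range k, (t - s) ^ i • a i

/-- The primitive of `centredPoly s a k` that vanishes at `s`. -/
noncomputable def centredPrimitive (s : ℝ) (a : ℕ → X) (k : ℕ) (t : ℝ) : X :=
  ∑ i ∈ Finset.range k, ((t - s) ^ (i + 1) / ((i : ℝ) + 1)) • a i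

lemma hasDerivAt_centredPrimitive (a : ℕ → X) (t : ℝ) :
    HasDerivAt (centredPrimitive s a k) (centredPoly s a k t) t := by
  refine HasDerivAt.fun_sum fun i _ => ?_
  refine HasDerivAt.smul_const ?_ _
  have hi : (i : ℝ) + 1 ≠ 0 := by positivity
  have := (((hasDerivAt_id t).sub_const s).pow (i + 1)).div_const ((i : ℝ) + 1)
  convert! this using 1
  simp
  field_simp

lemma contDiff_centredPrimitive (a : ℕ → X) {m : WithTop ℕ∞} :
    ContDiff ℝ m (centredPrimitive s a k) := by
  unfold centredPrimitive
  fun_prop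

@[simp] lemma centredPrimitive_self (a : ℕ → X) : centredPrimitive s a k s = 0 := by
  simp [centredPrimitive]

lemma ContDiffAt.deriv_of_succ {g : ℝ → X} (hg : ContDiffAt ℝ (k + 1 : ℕ) g s) :
    ContDiffAt ℝ k (deriv g) s := by
  have h : ContDiffAt ℝ k (fderiv ℝ g) s := hg.fderiv_right (by norm_cast)
  have h2 : ContDiffAt ℝ k (fun t => fderiv ℝ g t 1) s := h.clm_apply contDiffAt_const
  simpa only [fderiv_apply_one_eq_deriv] using h2

lemma ContDiffAt.eventually_differentiableAt_of_succ {g : ℝ → X}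
    (hg : ContDiffAt ℝ (k + 1 : ℕ) g s) : ∀ᶠ t in 𝓝 s, DifferentiableAt ℝ g t := by
  filter_upwards [hg.eventually (by simp)] with t ht
  exact ht.differentiableAt (by simp)

lemma ContDiffAt.exists_sub_centredPoly_isBigO : ∀ {k : ℕ} {g : ℝ → X}, ContDiffAt ℝ k g s →
    ∃ a : ℕ → X, (fun t => g t - centredPoly s a k t) =O[𝓝 s] fun t => (t - s) ^ k
  | 0, g, hg => ⟨0, by simpa [centredPoly] using hg.continuousAt.isBigO_one ℝ⟩
  | k + 1, g, hg => by
    obtain ⟨a, ha⟩ := hg.deriv_of_succ.exists_sub_centredPoly_isBigO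
    refine ⟨fun i => Nat.casesOn i (g s) fun i => ((i : ℝ) + 1)⁻¹ • a i, ?_⟩
    have h : (fun t => g t - g s - centredPrimitive s a k t) =O[𝓝 s]
        fun t => (t - s) ^ (k + 1) := by
      refine isBigO_sub_pow_of_deriv ?_ (by simp) (ha.congr' ?_ .rfl)
      · filter_upwards [hg.eventually_differentiableAt_of_succ] with t ht
        exact (ht.sub_const _).sub (hasDerivAt_centredPrimitive a t).differentiableAt
      · filter_upwards [hg.eventually_differentiableAt_of_succ] with t ht
        exact ((ht.hasDerivAt.sub_const _).sub (hasDerivAt_centredPrimitive a t)).deriv.symm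
    refine h.congr_left fun t => ?_
    simp only [centredPoly, centredPrimitive, Finset.sum_range_succ', pow_zero, one_smul,
      smul_smul, div_eq_mul_inv]
    rw [sub_sub, add_comm (g s)]
    rfl

/-- Taylor's formula for a curve together with its derivative. The remainder `z` is as smooth as the
curve itself, and may be smoother than the degree of the expansion requires. -/
lemma ContDiffAt.exists_eq_centredPrimitive_add {g : ℝ → X} {m : ℕ} (hg : ContDiffAt ℝ m g s)
    (hk : k + 1 ≤ m) :
    ∃ a : ℕ → X, ∃ z : ℝ → X, ContDiffAt ℝ m z s ∧ z s = 0 ∧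
      (∀ t, g t = g s + centredPrimitive s a k t + z t) ∧
      (∀ᶠ t in 𝓝 s, deriv g t = centredPoly s a k t + deriv z t) ∧
      z =O[𝓝 s] (fun t => (t - s) ^ (k + 1)) ∧ deriv z =O[𝓝 s] (fun t => (t - s) ^ k) := by
  have hgk : ContDiffAt ℝ (k + 1 : ℕ) g s := hg.of_le (by exact_mod_cast hk)
  obtain ⟨a, ha⟩ := hgk.deriv_of_succ.exists_sub_centredPoly_isBigO
  have hd : ∀ᶠ t in 𝓝 s, HasDerivAt (fun t => g t - g s - centredPrimitive s a k t)
      (deriv g t - centredPoly s a k t) t := by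
    filter_upwards [hgk.eventually_differentiableAt_of_succ] with t ht
    exact (ht.hasDerivAt.sub_const _).sub (hasDerivAt_centredPrimitive a t)
  have hz : deriv (fun t => g t - g s - centredPrimitive s a k t) =O[𝓝 s]
      (fun t => (t - s) ^ k) := by
    refine ha.congr' ?_ .rfl
    filter_upwards [hd] with t ht using ht.deriv.symm
  refine ⟨a, fun t => g t - g s - centredPrimitive s a k t, ?_, by simp,
    fun t => by beta_reduce; abel, ?_, isBigO_sub_pow_of_deriv (hd.mono fun t ht => ht.differentiableAt) (by simp) hz, hz⟩
  · exact (hg.sub contDiffAt_const).sub (contDiff_centredPrimitive a).contDiffAt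
  · filter_upwards [hd] with t ht
    rw [ht.deriv]; abel

lemma tendsto_add_mul_nhdsGT (s c : ℝ) : Tendsto (fun h : ℝ => s + c * h) (𝓝[>] 0) (𝓝 s) := by
  have : Tendsto (fun h : ℝ => s + c * h) (𝓝 0) (𝓝 (s + c * 0)) :=
    (continuous_const.add (continuous_const.mul continuous_id)).tendsto 0
  simpa using this.mono_left nhdsWithin_le_nhds

omit [NormedSpace ℝ X] in
lemma Asymptotics.IsBigO.comp_add_mul {g : ℝ → X}
    (hg : g =O[𝓝 s] fun t => (t - s) ^ k) (c : ℝ) :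
    (fun h : ℝ => g (s + c * h)) =O[𝓝[>] 0] fun h => h ^ k := by
  refine (hg.comp_tendsto (tendsto_add_mul_nhdsGT s c)).trans ?_
  simp only [Function.comp_def, add_sub_cancel_left, mul_pow]
  exact isBigO_const_mul_self _ _ _

/-! ### Defects of integration formulas -/

variable {w c : Fin n → ℝ} {β u v : ℝ}

/-- An integration formula `∑ w j * g' (c j) = β * (g u - g v)` that holds for the monomials of
degree less than `k` holds, after scaling by the step size `h`, for all centred polynomials. -/
lemma smul_sum_centredPoly (a : ℕ → X)
    (hw : ∀ i < k, ∑ j, w j * c j ^ i = β * (u ^ (i + 1) - v ^ (i + 1)) / ((i : ℝ) + 1))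
    (h : ℝ) :
    h • ∑ j, w j • centredPoly s a k (s + c j * h) =
      β • (centredPrimitive s a k (s + u * h) - centredPrimitive s a k (s + v * h)) := by
  simp only [centredPoly, centredPrimitive, add_sub_cancel_left, ← Finset.sum_sub_distrib,
    Finset.smul_sum, smul_smul, ← sub_smul]
  rw [Finset.sum_comm]
  refine Finset.sum_congr rfl fun i hi => ?_
  rw [← Finset.sum_smul]
  congr 1
  have hi := hw i (Finset.mem_range.1 hi)
  calc ∑ j, h * (w j * (c j * h) ^ i) = h ^ (i + 1) * ∑ j, w j * c j ^ i := by
        rw [Finset.mul_sum]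
        exact Finset.sum_congr rfl fun j _ => by ring
    _ = _ := by rw [hi]; ring

/-- The error of an integration formula that is exact in degrees less than `k`, on a smooth curve.
The quadrature rule of a Runge–Kutta method, its stages and its adjoint are all of this form. -/
lemma ContDiffAt.defect_isBigO {g : ℝ → X} (hg : ContDiffAt ℝ (k + 1 : ℕ) g s)
    (hw : ∀ i < k, ∑ j, w j * c j ^ i = β * (u ^ (i + 1) - v ^ (i + 1)) / ((i : ℝ) + 1)) :
    (fun h : ℝ => h • ∑ j, w j • deriv g (s + c j * h) - β • (g (s + u * h) - g (s + v * h)))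
      =O[𝓝[>] 0] fun h => h ^ (k + 1) := by
  obtain ⟨a, z, -, -, hgz, hgz', hz, hz'⟩ := hg.exists_eq_centredPrimitive_add le_rfl
  have key : (fun h : ℝ => h • ∑ j, w j • deriv z (s + c j * h) -
      β • (z (s + u * h) - z (s + v * h))) =O[𝓝[>] 0] fun h => h ^ (k + 1) := by
    refine IsBigO.sub ?_ (((hz.comp_add_mul u).sub (hz.comp_add_mul v)).const_smul_left β)
    have h1 : (fun h : ℝ => ∑ j, w j • deriv z (s + c j * h)) =O[𝓝[>] 0] fun h => h ^ k :=
      IsBigO.fun_sum fun j _ => (hz'.comp_add_mul (c j)).const_smul_left (w j)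
    simpa only [pow_succ', smul_eq_mul] using (isBigO_refl (fun h : ℝ => h) _).smul h1
  refine key.congr' ?_ .rfl
  have hev : ∀ᶠ h in 𝓝[>] (0 : ℝ), ∀ j, deriv g (s + c j * h) =
      centredPoly s a k (s + c j * h) + deriv z (s + c j * h) :=
    eventually_all.2 fun j => (tendsto_add_mul_nhdsGT s (c j)).eventually hgz'
  filter_upwards [hev] with h hh
  simp only [hh, smul_add, Finset.sum_add_distrib, smul_sum_centredPoly a hw,
    hgz (s + u * h), hgz (s + v * h), smul_sub]
  abel

/-! ### Linearization along a solution -/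

lemma isBigO_sub_pow_of_le {i j : ℕ} (hij : i ≤ j) :
    (fun t : ℝ => (t - s) ^ j) =O[𝓝 s] fun t => (t - s) ^ i := by
  refine IsBigO.of_bound 1 ?_
  filter_upwards [closedBall_mem_nhds s one_pos] with t ht
  rw [mem_closedBall, Real.dist_eq] at ht
  simp only [norm_pow, Real.norm_eq_abs, one_mul]
  exact pow_le_pow_of_le_one (abs_nonneg _) ht hij

/-- A function `U` that solves the adjoint variational equation `U' = -U J`, `U s = 1` up to order
`q`. It is built as a polynomial: a truncation suffices for the order of the method, and it is
smoother than `J`. -/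
lemma exists_approx_adjoint_solution {J : ℝ → X →L[ℝ] X} {p : ℕ}
    (hJ : ContDiffAt ℝ p J s) {q : ℕ} (hqp : q ≤ p) :
    ∃ U : ℝ → X →L[ℝ] X, ContDiff ℝ (p + 1 : ℕ) U ∧ U s = 1 ∧
      (fun t => deriv U t + U t * J t) =O[𝓝 s] fun t => (t - s) ^ q := by
  suffices H : ∀ k ≤ q, ∃ U : ℝ → X →L[ℝ] X, ContDiff ℝ (p + 1 : ℕ) U ∧ U s = 1 ∧
      (fun t => deriv U t + U t * J t) =O[𝓝 s] fun t => (t - s) ^ k from H q le_rfl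
  have hJ1 : J =O[𝓝 s] fun _ => (1 : ℝ) := hJ.continuousAt.isBigO_one ℝ
  -- each Picard step, with the integrand replaced by its Taylor polynomial, gains one order
  intro k
  induction k with
  | zero =>
    intro _
    refine ⟨fun _ => 1, contDiff_const, rfl, ?_⟩
    simpa using hJ1
  | succ k ih =>
    intro hk
    obtain ⟨U, hU, hUs, hUJ⟩ := ih (by omega)
    have hUJq : ContDiffAt ℝ q (fun t => U t * J t) s :=
      ((hU.contDiffAt.of_le (by norm_cast; omega)).clm_comp
        (hJ.of_le (by exact_mod_cast hqp)))
    obtain ⟨a, ha⟩ := hUJq.exists_sub_centredPoly_isBigO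
    set W : ℝ → X →L[ℝ] X := fun t => 1 - centredPrimitive s a q t with hW
    have hWd : ∀ t, HasDerivAt W (-centredPoly s a q t) t := fun t =>
      (hasDerivAt_centredPrimitive a t).const_sub 1
    have hUd : ∀ t, HasDerivAt U (deriv U t) t := fun t =>
      (hU.differentiable (by simp) t).hasDerivAt
    have hWU : (fun t => W t - U t) =O[𝓝 s] fun t => (t - s) ^ (k + 1) := by
      refine isBigO_sub_pow_of_deriv (.of_forall fun t => ((hWd t).sub (hUd t)).differentiableAt)
        (by simp [hW, hUs]) ?_
      have : deriv (fun t => W t - U t) =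
          fun t => (U t * J t - centredPoly s a q t) - (deriv U t + U t * J t) := by
        funext t
        rw [((hWd t).fun_sub (hUd t)).deriv]; abel
      rw [this]
      exact (ha.trans (isBigO_sub_pow_of_le (by omega))).sub hUJ
    refine ⟨W, contDiff_const.sub (contDiff_centredPrimitive a), by simp [hW], ?_⟩
    have h1 : (fun t => (W t - U t) * J t) =O[𝓝 s] fun t => (t - s) ^ (k + 1) := by
      simpa using hWU.mul hJ1
    refine ((ha.trans (isBigO_sub_pow_of_le hk)).add h1).congr_left fun t => ?_
    rw [(hWd t).deriv, sub_mul]; abel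

lemma ContDiffAt.exists_norm_sub_sub_fderiv_le {Y : Type*} [NormedAddCommGroup Y]
    [NormedSpace ℝ Y] {F : X → Y} {x₀ : X} (hF : ContDiffAt ℝ 2 F x₀) :
    ∃ K : ℝ, ∃ ε > 0, ∀ x ∈ ball x₀ ε, ∀ y ∈ ball x₀ ε,
      ‖F y - F x - fderiv ℝ F x (y - x)‖ ≤ K * ‖y - x‖ ^ 2 := by
  have hF' : ContDiffAt ℝ 1 (fderiv ℝ F) x₀ := hF.fderiv_right (by norm_num)
  obtain ⟨K, t, ht, hK⟩ := hF'.exists_lipschitzOnWith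
  have hd : ∀ᶠ x in 𝓝 x₀, DifferentiableAt ℝ F x := by
    filter_upwards [hF.eventually (by simp)] with x hx
    exact hx.differentiableAt (by simp)
  obtain ⟨ε, hε, hb⟩ := Metric.eventually_nhds_iff_ball.1 (hd.and ht)
  refine ⟨K, ε, hε, fun x hx y hy => ?_⟩
  have hseg : segment ℝ x y ⊆ ball x₀ ε := (convex_ball x₀ ε).segment_subset hx hy
  have := (convex_segment x y).norm_image_sub_le_of_norm_fderiv_le' (φ := fderiv ℝ F x)
    (C := K * ‖y - x‖) (fun z hz => (hb z (hseg hz)).1) (fun z hz => ?_)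
    (left_mem_segment ℝ x y) (right_mem_segment ℝ x y)
  · rwa [sq, ← mul_assoc]
  · refine (hK.norm_sub_le (hb z (hseg hz)).2 (hb x hx).2).trans ?_
    gcongr
    exact norm_sub_le_of_mem_segment hz

/-- The discrete adjoint identity. Here `E` are the stage errors, `J` the Jacobians at the nodes,
`U` and `U'` the adjoint solution and its derivative at the nodes, `Ue` its value at the end of the
step, `D` the defects of the adjoint integration formula, `z` and `z'` the Taylor remainder of the exact
solution and its derivative, and `r` the nonlinear remainders. The identity expresses the linearized
error of the step, transported by `Ue`, through the quadrature of `(U z)'` and `z'` and through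
products of two small quantities. -/
lemma weighted_linearized_error_eq (A : Matrix (Fin n) (Fin n) ℝ) (b : Fin n → ℝ) (h : ℝ)
    (Ue : X →L[ℝ] X) (U U' J D : Fin n → X →L[ℝ] X) (E z z' r : Fin n → X)
    (hD : ∀ j, D j = h • ∑ i, (b i * A i j) • U' i - b j • (Ue - U j))
    (hE : ∀ i, E i - h • ∑ j, A i j • J j (E j) =
      h • ∑ j, A i j • z' j - z i + h • ∑ j, A i j • r j) :
    Ue (∑ j, b j • J j (E j)) =
      ∑ j, b j • (U' j (z j) + U j (z' j)) - Ue (∑ j, b j • z' j) - ∑ j, D j (z' j) -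
        ∑ j, D j (J j (E j)) + ∑ j, b j • (U' j + U j * J j) (E j) -
        h • ∑ i, b i • U' i (∑ j, A i j • r j) := by
  -- summation by parts: `∑ b i • U' i` passes from the stage sums to the end of the step
  have hS : ∀ w : Fin n → X, h • ∑ i, b i • U' i (∑ j, A i j • w j) =
      ∑ j, D j (w j) + (Ue (∑ j, b j • w j) - ∑ j, b j • U j (w j)) := by
    intro w
    simp only [hD, map_sum, map_smul, _root_.sub_apply,
      _root_.smul_apply, _root_.sum_apply, Finset.sum_sub_distrib,
      smul_sub, Finset.smul_sum, smul_smul]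
    rw [Finset.sum_comm]
    abel
  have hmul : ∀ j, (U j * J j) (E j) = U j (J j (E j)) := fun _ => rfl
  have h1 : ∑ i, b i • U' i (E i - h • ∑ j, A i j • J j (E j)) =
      ∑ i, b i • U' i (h • ∑ j, A i j • z' j - z i + h • ∑ j, A i j • r j) := by simp only [hE]
  simp only [map_sub, map_add, map_smul, smul_sub, smul_add, Finset.sum_sub_distrib,
    Finset.sum_add_distrib, smul_comm _ h, ← Finset.smul_sum, hS z',
    hS fun j => J j (E j)] at h1
  simp only [smul_add, Finset.sum_add_distrib, _root_.add_apply,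
    hmul]
  rw [← sub_eq_zero] at h1 ⊢
  rw [← neg_eq_zero, ← h1]
  abel

lemma isBigO_pow_of_le {i j : ℕ} (hij : i ≤ j) :
    (fun h : ℝ => h ^ j) =O[𝓝[>] 0] fun h => h ^ i :=
  by simpa using (isBigO_sub_pow_of_le (s := 0) hij).mono nhdsWithin_le_nhds

lemma Asymptotics.IsBigO.clm_apply {T : ℝ → X →L[ℝ] X} {v : ℝ → X} {f g : ℝ → ℝ} {l : Filter ℝ}
    (hT : T =O[l] f) (hv : v =O[l] g) : (fun h => T h (v h)) =O[l] fun h => f h * g h := by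
  refine (IsBigO.of_bound 1 (.of_forall fun h => ?_)).trans (hT.norm_left.mul hv.norm_left)
  simpa using (T h).le_opNorm (v h)

/-! ### Butcher's theorem for autonomous systems -/

/-- The local error for an autonomous system `x' = F x`, computed from any family `Y` of stages that
tends to the initial value with the step size. -/
theorem RungeKutta.local_error_isBigO (M : RungeKutta n) {p q : ℕ}
    (hB : M.QuadratureCondition p) (hC : M.StageCondition q) (hD : M.AdjointCondition q)
    (hq : q ≤ p) (hpq : p ≤ 2 * q + 1) {F : X → X} {α : ℝ → X} {s : ℝ}
    (hF : ContDiffAt ℝ (p + 1 : ℕ) F (α s)) (hα : ContDiffAt ℝ (p + 1 : ℕ) α s)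
    (hode : ∀ᶠ t in 𝓝 s, deriv α t = F (α t)) {Y : ℝ → Fin n → X}
    (hYt : ∀ j, Tendsto (fun h => Y h j) (𝓝[>] 0) (𝓝 (α s)))
    (hY : ∀ᶠ h in 𝓝[>] 0, ∀ i, Y h i = α s + h • ∑ j, M.A i j • F (Y h j)) :
    (fun h => α s + h • ∑ j, M.b j • F (Y h j) - α (s + h)) =O[𝓝[>] 0]
      fun h => h ^ (p + 1) := by
  have hid : (fun h : ℝ => h) =O[𝓝[>] 0] fun h : ℝ => h := isBigO_refl _ _
  have hnode : ∀ c, Tendsto (fun h : ℝ => s + c * h) (𝓝[>] 0) (𝓝 s) := tendsto_add_mul_nhdsGT s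
  have hat : ∀ c, Tendsto (fun h : ℝ => α (s + c * h)) (𝓝[>] 0) (𝓝 (α s)) := fun c =>
    hα.continuousAt.tendsto.comp (hnode c)
  have hodeh : ∀ᶠ h in 𝓝[>] (0 : ℝ), ∀ j, deriv α (s + M.c j * h) = F (α (s + M.c j * h)) :=
    eventually_all.2 fun j => (hnode _).eventually hode
  set E : ℝ → Fin n → X := fun h j => Y h j - α (s + M.c j * h) with hE
  set J : ℝ → X →L[ℝ] X := fun t => fderiv ℝ F (α t) with hJ
  have hJp : ContDiffAt ℝ p J s :=
    (hF.fderiv_right (m := (p : ℕ)) (by norm_cast)).comp s (hα.of_le (by norm_cast; omega))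
  have hJ1 : ∀ c, (fun h : ℝ => J (s + c * h)) =O[𝓝[>] 0] fun _ => (1 : ℝ) := fun c =>
    (hJp.continuousAt.tendsto.comp (hnode c)).isBigO_one ℝ
  -- the residuals of the exact solution in the stage equations
  set d : ℝ → Fin n → X := fun h i =>
    h • ∑ j, M.A i j • deriv α (s + M.c j * h) - (α (s + M.c i * h) - α s) with hd
  have hstage : ∀ i, ∀ m < q, ∑ j, M.A i j * M.c j ^ m =
      1 * (M.c i ^ (m + 1) - 0 ^ (m + 1)) / ((m : ℝ) + 1) := fun i m hm => by
    rw [hC m hm i]; simp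
  have hdO : d =O[𝓝[>] 0] fun h => h ^ (q + 1) := by
    refine isBigO_pi.2 fun i => ?_
    have := (hα.of_le (m := ((q + 1 : ℕ) : WithTop ℕ∞)) (by norm_cast; omega)).defect_isBigO
      (hstage i)
    simpa using this
  have hEd : ∀ᶠ h in 𝓝[>] (0 : ℝ), ∀ i, E h i =
      d h i + h • ∑ j, M.A i j • (F (Y h j) - F (α (s + M.c j * h))) := by
    filter_upwards [hY, hodeh] with h h1 h2 i
    simp only [hE, hd, h2, smul_sub, Finset.sum_sub_distrib]
    nth_rewrite 1 [h1 i]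
    abel
  have hFE : ∀ j, (fun h => F (Y h j) - F (α (s + M.c j * h))) =O[𝓝[>] 0] fun h => E h j := by
    intro j
    obtain ⟨K, t, ht, hK⟩ := (hF.of_le (m := 1) (by norm_cast; omega)).exists_lipschitzOnWith
    refine IsBigO.of_bound K ?_
    filter_upwards [(hYt j).eventually ht, (hat _).eventually ht] with h h1 h2
    exact hK.norm_sub_le h1 h2
  have hEj : ∀ j, (fun h => E h j) =O[𝓝[>] 0] E := fun j => isBigO_pi.1 (isBigO_refl _ _) j
  have hEO : E =O[𝓝[>] 0] fun h => h ^ (q + 1) := by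
    have h1 : (fun h => d h - E h) =o[𝓝[>] 0] E := by
      refine isLittleO_pi.2 fun i => ?_
      have h2 : (fun h => -(h • ∑ j, M.A i j • (F (Y h j) - F (α (s + M.c j * h)))))
          =o[𝓝[>] 0] E := by
        have h3 : (fun h : ℝ => h) =o[𝓝[>] 0] fun _ => (1 : ℝ) :=
          (isLittleO_one_iff ℝ).2 (tendsto_id.mono_left nhdsWithin_le_nhds)
        have h4 : (fun h => ∑ j, M.A i j • (F (Y h j) - F (α (s + M.c j * h)))) =O[𝓝[>] 0] E :=
          IsBigO.fun_sum fun j _ => ((hFE j).trans (hEj j)).const_smul_left _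
        simpa using (h3.smul_isBigO h4).neg_left
      refine h2.congr' ?_ .rfl
      filter_upwards [hEd] with h hh
      rw [Pi.sub_apply, hh i]; abel
    -- `d` is asymptotically equivalent to `E`
    exact (IsEquivalent.isBigO_symm h1).trans hdO
  have hEjO : ∀ j, (fun h => E h j) =O[𝓝[>] 0] fun h => h ^ (q + 1) := fun j =>
    (hEj j).trans hEO
  -- the remainder of the linearization of `F` along the solution
  set r : ℝ → Fin n → X := fun h j =>
    F (Y h j) - F (α (s + M.c j * h)) - J (s + M.c j * h) (E h j) with hr
  have hrO : ∀ j, (fun h => r h j) =O[𝓝[>] 0] fun h => h ^ p := by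
    intro j
    -- for `p = 0` only one derivative of `F` is available, but no decay of the remainder is needed
    rcases Nat.eq_zero_or_pos p with hp | hp
    · have h1 : (fun h => r h j) =O[𝓝[>] 0] fun h => h ^ (q + 1) :=
        ((hFE j).trans (hEjO j)).sub (by simpa using (hJ1 (M.c j)).clm_apply (hEjO j))
      exact h1.trans (isBigO_pow_of_le (by omega))
    · obtain ⟨K, ε, hε, hK⟩ :=
        (hF.of_le (m := 2) (by norm_cast; omega)).exists_norm_sub_sub_fderiv_le
      have h1 : (fun h => r h j) =O[𝓝[>] 0] fun h => ‖E h j‖ ^ 2 := by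
        refine IsBigO.of_bound K ?_
        filter_upwards [(hYt j).eventually (ball_mem_nhds _ hε),
          (hat (M.c j)).eventually (ball_mem_nhds _ hε)] with h h1 h2
        simpa only [hr, hE, hJ, norm_pow, norm_norm] using hK _ h2 _ h1
      refine (h1.trans ((hEjO j).norm_left.pow 2)).trans ?_
      simp only [← pow_mul]
      exact isBigO_pow_of_le (by omega)
  obtain ⟨U, hU, hUs, hUJ⟩ := exists_approx_adjoint_solution hJp hq
  have hU1 : ∀ c, (fun h : ℝ => U (s + c * h)) =O[𝓝[>] 0] fun _ => (1 : ℝ) := fun c =>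
    (hU.continuous.continuousAt.tendsto.comp (hnode c)).isBigO_one ℝ
  have hU1' : ∀ c, (fun h : ℝ => deriv U (s + c * h)) =O[𝓝[>] 0] fun _ => (1 : ℝ) := fun c =>
    (hU.contDiffAt.deriv_of_succ.continuousAt.tendsto.comp (hnode c)).isBigO_one ℝ
  -- the residuals of `U` in the adjoint integration formula
  set D : ℝ → Fin n → X →L[ℝ] X := fun h j =>
    h • ∑ i, (M.b i * M.A i j) • deriv U (s + M.c i * h) -
      M.b j • (U (s + 1 * h) - U (s + M.c j * h)) with hDdef
  have hDO : ∀ j, (fun h => D h j) =O[𝓝[>] 0] fun h => h ^ (q + 1) := by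
    intro j
    refine (hU.contDiffAt.of_le (m := ((q + 1 : ℕ) : WithTop ℕ∞))
      (by norm_cast; omega)).defect_isBigO fun m hm => ?_
    rw [hD m hm j, one_pow]
  -- the Taylor polynomial of degree `q` of `α` does not contribute to the residuals `d`
  obtain ⟨a, z, hz, hzs, hαz, hαz', hzO, hzO'⟩ :=
    hα.exists_eq_centredPrimitive_add (k := q) (by omega)
  have hαz'h : ∀ᶠ h in 𝓝[>] (0 : ℝ), ∀ j, deriv α (s + M.c j * h) =
      centredPoly s a q (s + M.c j * h) + deriv z (s + M.c j * h) :=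
    eventually_all.2 fun j => (hnode _).eventually hαz'
  have hdz : ∀ᶠ h in 𝓝[>] (0 : ℝ), ∀ i, d h i =
      h • ∑ j, M.A i j • deriv z (s + M.c j * h) - z (s + M.c i * h) := by
    filter_upwards [hαz'h] with h hh i
    have := smul_sum_centredPoly a (hstage i) h (s := s)
    simp only [hd, hh, smul_add, Finset.sum_add_distrib, this, hαz (s + M.c i * h), zero_mul,
      add_zero, centredPrimitive_self, one_smul, sub_zero]
    abel
  -- quadrature of the derivatives of `α`, `U z` and `z`
  have hquad : ∀ m < p, ∑ j, M.b j * M.c j ^ m =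
      1 * (1 ^ (m + 1) - 0 ^ (m + 1)) / ((m : ℝ) + 1) := fun m hm => by
    rw [hB m hm]; simp
  have hQα := hα.defect_isBigO hquad
  have hQz := hz.defect_isBigO hquad
  have hUz : ContDiffAt ℝ (p + 1 : ℕ) (fun t => U t (z t)) s := hU.contDiffAt.clm_apply hz
  have hQUz := hUz.defect_isBigO hquad
  have hUz' : ∀ᶠ h in 𝓝[>] (0 : ℝ), ∀ j, deriv (fun t => U t (z t)) (s + M.c j * h) =
      deriv U (s + M.c j * h) (z (s + M.c j * h)) +
        U (s + M.c j * h) (deriv z (s + M.c j * h)) := by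
    refine eventually_all.2 fun j => (hnode (M.c j)).eventually
      (p := fun t => deriv (fun t => U t (z t)) t = deriv U t (z t) + U t (deriv z t)) ?_
    filter_upwards [hz.eventually_differentiableAt_of_succ] with t ht
    exact ((hU.differentiable (by simp) t).hasDerivAt.clm_apply ht.hasDerivAt).deriv
  set V : ℝ → X := fun h => h • ∑ j, M.b j • J (s + M.c j * h) (E h j) with hV
  have hVU : (fun h => U (s + 1 * h) (V h)) =O[𝓝[>] 0] fun h => h ^ (p + 1) := by
    have hzj : ∀ j, (fun h => deriv z (s + M.c j * h)) =O[𝓝[>] 0] fun h => h ^ q := fun j =>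
      hzO'.comp_add_mul (M.c j)
    have hρj : ∀ j, (fun h => deriv U (s + M.c j * h) + U (s + M.c j * h) * J (s + M.c j * h))
        =O[𝓝[>] 0] fun h => h ^ q := fun j => hUJ.comp_add_mul (M.c j)
    -- `D` and `E` contribute `q + 1` powers of `h`, `deriv z` and the residual of `U` contribute `q`;
    -- with the factor `h` the products below are of order at least `2 * q + 2 ≥ p + 1`
    have hT1 : (fun h => h • ∑ j, D h j (deriv z (s + M.c j * h))) =O[𝓝[>] 0]
        fun h => h ^ (p + 1) := by
      refine (hid.smul (IsBigO.fun_sum fun j _ => (hDO j).clm_apply (hzj j))).trans ?_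
      refine (isBigO_pow_of_le (j := 2 * q + 2) (by omega)).congr_left fun h => ?_
      simp only [smul_eq_mul]; ring
    have hT2 : (fun h => h • ∑ j, D h j (J (s + M.c j * h) (E h j))) =O[𝓝[>] 0]
        fun h => h ^ (p + 1) := by
      refine (hid.smul (IsBigO.fun_sum fun j _ =>
        (hDO j).clm_apply ((hJ1 (M.c j)).clm_apply (hEjO j)))).trans ?_
      refine (isBigO_pow_of_le (j := 2 * q + 3) (by omega)).congr_left fun h => ?_
      simp only [smul_eq_mul]; ring
    have hT3 : (fun h => h • ∑ j, M.b j • (deriv U (s + M.c j * h) +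
        U (s + M.c j * h) * J (s + M.c j * h)) (E h j)) =O[𝓝[>] 0] fun h => h ^ (p + 1) := by
      refine (hid.smul (IsBigO.fun_sum fun j _ =>
        ((hρj j).clm_apply (hEjO j)).const_smul_left (M.b j))).trans ?_
      refine (isBigO_pow_of_le (j := 2 * q + 2) (by omega)).congr_left fun h => ?_
      simp only [smul_eq_mul]; ring
    have hT4 : (fun h => h • h • ∑ i, M.b i • deriv U (s + M.c i * h)
        (∑ j, M.A i j • r h j)) =O[𝓝[>] 0] fun h => h ^ (p + 1) := by
      refine (hid.smul (hid.smul (IsBigO.fun_sum fun i _ =>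
        ((hU1' (M.c i)).clm_apply (IsBigO.fun_sum fun j _ =>
          (hrO j).const_smul_left (M.A i j))).const_smul_left (M.b i)))).trans ?_
      refine (isBigO_pow_of_le (j := p + 2) (by omega)).congr_left fun h => ?_
      simp only [smul_eq_mul]; ring
    have hT5 := ((hU1 1).clm_apply hQz).congr_right fun h => one_mul (h ^ (p + 1))
    refine (((((hQUz.sub hT5).sub hT1).sub hT2).add hT3).sub hT4).congr' ?_ .rfl
    filter_upwards [hEd, hdz, hUz'] with h h1 h2 h3
    have hR : ∀ i, E h i - h • ∑ j, M.A i j • J (s + M.c j * h) (E h j) =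
        h • ∑ j, M.A i j • deriv z (s + M.c j * h) - z (s + M.c i * h) +
          h • ∑ j, M.A i j • r h j := by
      intro i
      rw [← h2 i]
      nth_rewrite 1 [h1 i]
      simp only [hr, smul_sub, Finset.sum_sub_distrib]
      abel
    have key := weighted_linearized_error_eq M.A M.b h (U (s + 1 * h))
      (fun j => U (s + M.c j * h)) (fun j => deriv U (s + M.c j * h))
      (fun j => J (s + M.c j * h)) (D h) (E h) (fun j => z (s + M.c j * h))
      (fun j => deriv z (s + M.c j * h)) (r h) (fun _ => rfl) hR
    simp only [hV, map_smul, key, h3, smul_sub, smul_add, map_sub, one_smul, zero_mul, add_zero,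
      hzs, map_zero, sub_zero]
    abel
  -- `U` is close to the identity, so that `V` is equivalent to its image
  have hVO : V =O[𝓝[>] 0] fun h => h ^ (p + 1) := by
    have h1 : (fun h => U (s + 1 * h) (V h) - V h) =o[𝓝[>] 0] V := by
      have h2 : Tendsto (fun h : ℝ => ‖U (s + 1 * h) - 1‖) (𝓝[>] 0) (𝓝 0) := by
        have := (hU.continuous.continuousAt.tendsto.comp (hnode 1))
        rw [hUs] at this
        simpa using (this.sub_const 1).norm
      have h3 : (fun h => ‖U (s + 1 * h) - 1‖ * ‖V h‖) =o[𝓝[>] 0] fun h => 1 * ‖V h‖ :=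
        ((isLittleO_one_iff ℝ).2 h2).mul_isBigO (isBigO_refl _ _)
      simp only [one_mul] at h3
      refine IsBigO.trans_isLittleO (IsBigO.of_bound 1 (.of_forall fun h => ?_)) h3.of_norm_right
      have := (U (s + 1 * h) - 1).le_opNorm (V h)
      simpa using this
    exact (IsEquivalent.isBigO_symm h1).trans hVU
  have hbr : (fun h => h • ∑ j, M.b j • r h j) =O[𝓝[>] 0] fun h => h ^ (p + 1) := by
    simp only [pow_succ' _ p]
    exact hid.smul (IsBigO.fun_sum fun j _ => (hrO j).const_smul_left _)
  refine ((hQα.add hVO).add hbr).congr' ?_ .rfl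
  filter_upwards [hodeh] with h hh
  simp only [hV, hr, hh, smul_sub, Finset.sum_sub_distrib, one_smul, one_mul, zero_mul, add_zero]
  abel

/-! ### Solvability of the stage equations and the exact solution -/

lemma Matrix.exists_norm_sum_smul_le (A : Matrix (Fin n) (Fin n) ℝ) :
    ∃ a : ℝ, 0 ≤ a ∧ ∀ (v : Fin n → X) (C : ℝ), (∀ j, ‖v j‖ ≤ C) → 0 ≤ C →
      ∀ i, ‖∑ j, A i j • v j‖ ≤ a * C := by
  refine ⟨∑ i, ∑ j, |A i j|, by positivity, fun v C hv hC i => ?_⟩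
  calc ‖∑ j, A i j • v j‖ ≤ ∑ j, |A i j| * C := norm_sum_le_of_le _ fun j _ => by
        rw [norm_smul, Real.norm_eq_abs]
        gcongr
        exact hv j
    _ = (∑ j, |A i j|) * C := by rw [Finset.sum_mul]
    _ ≤ _ := by
        refine mul_le_mul_of_nonneg_right ?_ hC
        exact Finset.single_le_sum (f := fun i => ∑ j, |A i j|) (fun _ _ => by positivity)
          (Finset.mem_univ i)

/-- For small step sizes the stage map is a contraction of a fixed ball around the initial value. -/
lemma exists_existsUnique_stages [CompleteSpace X] (A : Matrix (Fin n) (Fin n) ℝ) {F : X → X}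
    {x₀ : X} (hF : ContDiffAt ℝ 1 F x₀) :
    ∃ r > 0, ∃ B, (∀ x ∈ closedBall x₀ r, ‖F x‖ ≤ B) ∧ ∃ h₀ > 0, ∀ h : ℝ, 0 < h → h ≤ h₀ →
      ∃! Y : Fin n → X, (∀ k, Y k ∈ closedBall x₀ r) ∧
        ∀ k, Y k = x₀ + h • ∑ j, A k j • F (Y j) := by
  obtain ⟨K, t, ht, hK⟩ := hF.exists_lipschitzOnWith
  obtain ⟨r, hr, hrt⟩ := Metric.nhds_basis_closedBall.mem_iff.1 ht
  have hr0 : (0 : ℝ) ≤ r := hr.le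
  have hB : ∀ x ∈ closedBall x₀ r, ‖F x‖ ≤ ‖F x₀‖ + K * r := by
    intro x hx
    have h1 := hK.norm_sub_le (hrt hx) (mem_of_mem_nhds ht)
    have h2 : ‖x - x₀‖ ≤ r := by rwa [← mem_closedBall_iff_norm]
    have h3 := norm_le_norm_add_norm_sub' (F x) (F x₀)
    have h4 : (K : ℝ) * ‖x - x₀‖ ≤ K * r := by gcongr
    linarith
  set B := ‖F x₀‖ + K * r with hBdef
  have hB0 : 0 ≤ B := by positivity
  obtain ⟨a, ha, hA⟩ := A.exists_norm_sum_smul_le (X := X)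
  refine ⟨r, hr, B, hB, min (r / (a * B + 1)) (1 / (2 * (a * K + 1))), by positivity,
    fun h h0 hh => ?_⟩
  have hh1 : h * (a * B) ≤ r := by
    have := (le_div_iff₀ (by positivity)).1 (hh.trans (min_le_left _ _))
    linarith
  have hh2 : h * (a * K) ≤ 1 / 2 := by
    have := (le_div_iff₀ (by positivity)).1 (hh.trans (min_le_right _ _))
    linarith
  set Φ : (Fin n → X) → Fin n → X := fun Y k => x₀ + h • ∑ j, A k j • F (Y j) with hΦ
  set S : Set (Fin n → X) := closedBall (fun _ => x₀) r with hS
  have hmem : ∀ Y, Y ∈ S ↔ ∀ k, Y k ∈ closedBall x₀ r := fun Y => by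
    simp only [hS, mem_closedBall, dist_pi_le_iff hr0]
  have hmaps : Set.MapsTo Φ S S := by
    intro Y hY
    rw [hmem] at hY ⊢
    intro k
    rw [mem_closedBall_iff_norm, hΦ, add_sub_cancel_left, norm_smul, Real.norm_eq_abs,
      abs_of_pos h0]
    refine le_trans ?_ hh1
    gcongr
    exact hA _ B (fun j => hB _ (hY j)) hB0 k
  have hcontr : ContractingWith (1 / 2) (hmaps.restrict Φ S S) := by
    refine ⟨by norm_num, LipschitzWith.of_dist_le_mul fun Y Z => ?_⟩
    have hY := (hmem _).1 Y.2
    have hZ := (hmem _).1 Z.2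
    rw [Subtype.dist_eq, Subtype.dist_eq, dist_pi_le_iff (by positivity)]
    intro k
    have h1 : ∀ j, ‖F (Y.1 j) - F (Z.1 j)‖ ≤ K * dist Y.1 Z.1 := fun j => by
      refine (hK.norm_sub_le (hrt (hY j)) (hrt (hZ j))).trans ?_
      rw [← dist_eq_norm]
      gcongr
      exact dist_le_pi_dist _ _ j
    have h2 := hA _ _ h1 (by positivity) k
    change dist (x₀ + _) (x₀ + _) ≤ _
    rw [dist_add_left, dist_eq_norm, ← smul_sub, ← Finset.sum_sub_distrib]
    simp only [← smul_sub]
    rw [norm_smul, Real.norm_eq_abs, abs_of_pos h0]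
    calc h * ‖∑ j, A k j • (F (Y.1 j) - F (Z.1 j))‖ ≤ h * (a * (K * dist Y.1 Z.1)) := by gcongr
      _ = h * (a * K) * dist Y.1 Z.1 := by ring
      _ ≤ 1 / 2 * dist Y.1 Z.1 := by gcongr
      _ = _ := by simp
  obtain ⟨Y, hYS, hYfix, -⟩ := hcontr.exists_fixedPoint' isClosed_closedBall.isComplete hmaps
    (mem_closedBall_self hr0) (edist_ne_top _ _)
  refine ⟨Y, ⟨(hmem Y).1 hYS, fun k => (congrFun hYfix k).symm⟩, ?_⟩
  rintro Z ⟨hZS, hZ⟩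
  have hZS' := (hmem Z).2 hZS
  have hYf : Function.IsFixedPt (hmaps.restrict Φ S S) ⟨Y, hYS⟩ := Subtype.ext hYfix
  have hZf : Function.IsFixedPt (hmaps.restrict Φ S S) ⟨Z, hZS'⟩ :=
    Subtype.ext (funext fun k => (hZ k).symm)
  exact congrArg Subtype.val (hcontr.fixedPoint_unique' hZf hYf)

/-- A solution of `x' = F x` is as smooth as `F`. -/
lemma ContDiffAt.of_hasDerivAt_comp {F : X → X} {α : ℝ → X} {s : ℝ} :
    ∀ {p : ℕ}, ContDiffAt ℝ p F (α s) → (∀ᶠ t in 𝓝 s, HasDerivAt α (F (α t)) t) →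
      ContDiffAt ℝ p α s
  | 0, _, hα => by
    obtain ⟨u, hu, h⟩ := Filter.eventually_iff_exists_mem.1 hα
    refine contDiffAt_zero.2 ⟨u, hu, fun t ht => (h t ht).continuousAt.continuousWithinAt⟩
  | p + 1, hF, hα => by
    have hp : ContDiffAt ℝ p α s :=
      ContDiffAt.of_hasDerivAt_comp (hF.of_le (by norm_cast; omega)) hα
    have hFα : ContDiffAt ℝ p (fun t => F (α t)) s :=
      ContDiffAt.comp s (hF.of_le (by norm_cast; omega)) hp
    obtain ⟨u, hu, h⟩ := Filter.eventually_iff_exists_mem.1 hα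
    refine contDiffAt_succ_iff_hasFDerivAt.2
      ⟨fun t => ContinuousLinearMap.toSpanSingleton ℝ (F (α t)),
        ⟨u, hu, fun t ht => (h t ht).hasFDerivAt⟩, ?_⟩
    exact (ContinuousLinearMap.toSpanSingletonCLE (𝕜 := ℝ) (E := X)).contDiff.contDiffAt.comp s hFα

/-- A one-sided solution on `[s, s + δ]` agrees, just after `s`, with any solution defined on both
sides of `s`. The nodes of the method may lie on either side of the step, so the latter is needed. -/
lemma eventually_eq_of_hasDerivWithinAt {F : X → X} {α γ : ℝ → X} {s δ : ℝ}
    (hF : ContDiffAt ℝ 1 F (α s)) (hα : ∀ᶠ t in 𝓝 s, HasDerivAt α (F (α t)) t) (hδ : 0 < δ)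
    (hγ : ∀ t ∈ Set.Icc s (s + δ), HasDerivWithinAt γ (F (γ t)) (Set.Icc s (s + δ)) t)
    (h0 : γ s = α s) : ∀ᶠ h in 𝓝[>] (0 : ℝ), γ (s + h) = α (s + h) := by
  obtain ⟨K, u, hu, hK⟩ := hF.exists_lipschitzOnWith
  have hsδ : s < s + δ := by linarith
  have hγc : ContinuousWithinAt γ (Set.Ici s) s :=
    (hγ s ⟨le_rfl, hsδ.le⟩).continuousWithinAt.mono_of_mem_nhdsWithin (Icc_mem_nhdsGE hsδ)
  have hev : ∀ᶠ t in 𝓝[≥] s, (HasDerivAt α (F (α t)) t ∧ α t ∈ u) ∧ γ t ∈ u ∧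
      t ∈ Set.Ico s (s + δ) := by
    have h1 := hα.and (hα.self_of_nhds.continuousAt.eventually hu)
    exact (h1.filter_mono nhdsWithin_le_nhds).and
      ((hγc.eventually (h0 ▸ hu)).and (Ico_mem_nhdsGE hsδ))
  obtain ⟨e, he, hsub⟩ := mem_nhdsGE_iff_exists_Icc_subset.1 hev
  have heq : Set.EqOn γ α (Set.Icc s e) := by
    refine ODE_solution_unique_of_mem_Icc_right (v := fun _ => F) (s := fun _ => u) (K := K)
      (fun _ _ => hK) (fun t ht => ?_) (fun t ht => ?_)
      (fun t ht => (hsub (Set.Ico_subset_Icc_self ht)).2.1)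
      (fun t ht => (hsub ht).1.1.continuousAt.continuousWithinAt)
      (fun t ht => (hsub (Set.Ico_subset_Icc_self ht)).1.1.hasDerivWithinAt)
      (fun t ht => (hsub (Set.Ico_subset_Icc_self ht)).1.2) h0
    · refine (hγ t (Set.Ico_subset_Icc_self (hsub ht).2.2)).continuousWithinAt.mono fun x hx => ?_
      exact Set.Ico_subset_Icc_self (hsub hx).2.2
    · have ht' := (hsub (Set.Ico_subset_Icc_self ht)).2.2
      exact (hγ t (Set.Ico_subset_Icc_self ht')).mono_of_mem_nhdsWithin
        (Icc_mem_nhdsGE_of_mem ht')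
  have hmem : Set.Ioc 0 (e - s) ∈ 𝓝[>] (0 : ℝ) := Ioc_mem_nhdsGT (sub_pos.2 he)
  filter_upwards [hmem] with h hh
  exact heq ⟨by linarith [hh.1], by linarith [hh.2]⟩

/-! ### The order of the method -/

/-- Butcher's theorem: the simplifying assumptions `B(p)`, `C(q)`, `D(q)` with `p ≤ 2 q + 1` imply
classical order `p`. The row-sum condition `C(1)` reduces the system to the autonomous one on
`ℝ × E`, and `q ≤ p` limits the smoothness that the expansions ask for. -/
theorem RungeKutta.hasOrder_of_simplifyingConditions {n : ℕ} (M : RungeKutta n) {p q : ℕ}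
    (hB : M.QuadratureCondition p) (hC : M.StageCondition q) (hD : M.AdjointCondition q)
    (hrow : M.StageCondition 1) (hq : q ≤ p) (hpq : p ≤ 2 * q + 1) : M.HasOrder p := by
  intro E _ _ _ f s y δ hf hδ hy
  have : CompleteSpace E := FiniteDimensional.complete ℝ E
  set F : ℝ × E → ℝ × E := fun x => (1, f x.1 x.2) with hFdef
  have hF : ContDiffAt ℝ (p + 1 : ℕ) F (s, y s) := contDiffAt_const.prodMk hf
  have hF1 : ContDiffAt ℝ 1 F (s, y s) := hF.of_le (by norm_cast; omega)
  obtain ⟨α, hαs, ε, hε, hα⟩ :=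
    hF1.exists_forall_mem_closedBall_exists_eq_forall_mem_Ioo_hasDerivAt₀ s
  have hαev : ∀ᶠ t in 𝓝 s, HasDerivAt α (F (α t)) t := by
    filter_upwards [Ioo_mem_nhds (by linarith : s - ε < s) (by linarith : s < s + ε)] with t ht
    exact hα t ht
  rw [← hαs] at hF hF1
  have hαp : ContDiffAt ℝ (p + 1 : ℕ) α s := .of_hasDerivAt_comp hF hαev
  have hγ : ∀ᶠ h in 𝓝[>] (0 : ℝ), (s + h, y (s + h)) = α (s + h) :=
    eventually_eq_of_hasDerivWithinAt (γ := fun t => (t, y t)) hF1 hαev hδ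
      (fun t ht => (hasDerivWithinAt_id t _).prodMk (hy t ht)) hαs.symm
  obtain ⟨r, hr, B, hFB, h₀, hh₀, hst⟩ := exists_existsUnique_stages M.A hF1
  -- the stages of the autonomous system carry the times of the nodes as their first component
  have hstages : ∀ (h : ℝ) (Z : Fin n → ℝ × E),
      (∀ k, Z k = α s + h • ∑ j, M.A k j • F (Z j)) ↔
        (∀ k, (Z k).1 = s + M.c k * h) ∧ M.IsStages f s (y s) h fun k => (Z k).2 := by
    intro h Z
    have hrow' : ∀ k, ∑ j, M.A k j = M.c k := fun k => by simpa using hrow 0 one_pos k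
    have hfst : ∀ k, (α s + h • ∑ j, M.A k j • F (Z j)).1 = s + M.c k * h := fun k => by
      simp [hαs, hFdef, Prod.fst_sum, hrow', mul_comm]
    have hsnd : ∀ k, (α s + h • ∑ j, M.A k j • F (Z j)).2 =
        y s + h • ∑ j, M.A k j • f (Z j).1 (Z j).2 := fun k => by
      simp [hαs, hFdef, Prod.snd_sum]
    constructor
    · intro hZ
      have h1 : ∀ k, (Z k).1 = s + M.c k * h := fun k => by rw [hZ k, hfst]
      refine ⟨h1, fun k => ?_⟩
      simp only [← h1]
      rw [← hsnd k, ← hZ k]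
    · rintro ⟨h1, h2⟩ k
      refine Prod.ext (by rw [h1, hfst]) ?_
      rw [hsnd]
      simpa only [h1] using h2 k
  choose! Z hZ using fun h h1 h2 => (hst h h1 h2).exists
  have hsmall : Set.Ioc 0 h₀ ∈ 𝓝[>] (0 : ℝ) := Ioc_mem_nhdsGT hh₀
  have hZeq : ∀ᶠ h in 𝓝[>] (0 : ℝ), ∀ k, Z h k = α s + h • ∑ j, M.A k j • F (Z h j) := by
    filter_upwards [hsmall] with h hh using (hZ h hh.1 hh.2).2
  have hZt : ∀ k, Tendsto (fun h => Z h k) (𝓝[>] 0) (𝓝 (α s)) := by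
    intro k
    have h1 : (fun h => ∑ j, M.A k j • F (Z h j)) =O[𝓝[>] 0] fun _ => (1 : ℝ) := by
      have hFO : ∀ j, (fun h => F (Z h j)) =O[𝓝[>] 0] fun _ => (1 : ℝ) := fun j => by
        refine IsBigO.of_bound B ?_
        filter_upwards [hsmall] with h hh
        simpa using hFB _ ((hZ h hh.1 hh.2).1 j)
      exact IsBigO.fun_sum fun j _ => (hFO j).const_smul_left (M.A k j)
    have h2 : Tendsto (fun h => h • ∑ j, M.A k j • F (Z h j)) (𝓝[>] 0) (𝓝 0) := by
      refine ((isBigO_refl (fun h : ℝ => h) _).smul h1).trans_tendsto ?_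
      simp only [smul_eq_mul, mul_one]
      exact tendsto_id.mono_left nhdsWithin_le_nhds
    have h3 := h2.const_add (α s)
    rw [add_zero] at h3
    refine h3.congr' ?_
    filter_upwards [hZeq] with h hh using (hh k).symm
  obtain ⟨C, hCb⟩ := (M.local_error_isBigO hB hC hD hq hpq hF hαp
    (hαev.mono fun t ht => ht.deriv) hZt hZeq).bound
  obtain ⟨e, he, hsub⟩ := mem_nhdsGT_iff_exists_Ioc_subset.1 (hCb.and hγ)
  have he' : (0 : ℝ) < e := he
  set a := ∑ k, |M.c k| with ha
  have ha0 : 0 ≤ a := by positivity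
  refine ⟨r, hr, min h₀ (min e (r / (a + 1))), by positivity, C, fun h h0 hh => ?_⟩
  have hhh₀ : h ≤ h₀ := hh.trans (min_le_left _ _)
  have hhe : h ≤ e := hh.trans ((min_le_right _ _).trans (min_le_left _ _))
  have hhr : h * (a + 1) ≤ r :=
    (le_div_iff₀ (by positivity)).1 (hh.trans ((min_le_right _ _).trans (min_le_right _ _)))
  have huniq : ∀ Y : Fin n → E, (∀ k, Y k ∈ closedBall (y s) r) → M.IsStages f s (y s) h Y →
      ∀ k, Z h k = (s + M.c k * h, Y k) := by
    intro Y hYb hY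
    have h1 : (fun k => (s + M.c k * h, Y k)) = Z h := by
      refine (hst h h0 hhh₀).unique ⟨fun k => ?_, (hstages h _).2 ⟨fun k => rfl, hY⟩⟩ (hZ h h0 hhh₀)
      rw [hαs, ← closedBall_prod_same]
      refine ⟨?_, hYb k⟩
      rw [mem_closedBall, Real.dist_eq, add_sub_cancel_left, abs_mul, abs_of_pos h0]
      have : |M.c k| ≤ a :=
        Finset.single_le_sum (f := fun k => |M.c k|) (fun _ _ => abs_nonneg _) (Finset.mem_univ k)
      nlinarith
    exact fun k => (congrFun h1 k).symm
  refine ⟨⟨fun k => (Z h k).2, ⟨fun k => ?_, ((hstages h _).1 (hZ h h0 hhh₀).2).2⟩, ?_⟩, ?_⟩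
  · have := (hZ h h0 hhh₀).1 k
    rw [hαs, ← closedBall_prod_same] at this
    exact this.2
  · rintro Y ⟨hYb, hY⟩
    funext k
    rw [huniq Y hYb hY k]
  · intro Y hYb hY
    obtain ⟨h1, h2⟩ := hsub ⟨h0, hhe⟩
    have h3 : M.update f s (y s) h Y - y (s + h) =
        (α s + h • ∑ j, M.b j • F (Z h j) - α (s + h)).2 := by
      simp [RungeKutta.update, ← h2, hαs, hFdef, Prod.snd_sum, huniq Y hYb hY]
    rw [h3]
    refine (norm_snd_le _).trans (h1.trans_eq ?_)
    rw [Real.norm_of_nonneg (by positivity)]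

end Analysis

theorem mainTheorem5 {n q τ : ℕ} (G : GSBPOperator n q) (χ₀ χ₁ : Fin n → ℝ)
    (hχ : G.IsSATCompatible χ₀ χ₁) (hinv : IsUnit (G.stepMatrix χ₀))
    (hdiag : G.H.IsDiag) (hτ : G.HasQuadratureOrder τ) :
    (G.toRungeKutta χ₀).HasOrder (min τ (2 * q + 1)) := by
  have hC := hχ.stageCondition hinv
  have hD := hχ.adjointCondition hinv hdiag
  -- `C` and `D` may be weakened to `min q p`, since `p ≤ 2 * p + 1`
  refine RungeKutta.hasOrder_of_simplifyingConditions (q := min q (min τ (2 * q + 1))) _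
    (fun m hm => hτ.quadratureCondition m (by omega)) (fun m hm => hC m (by omega))
    (fun m hm => hD m (by omega)) (fun m hm => hC m (by have := G.one_le_q; omega))
    (by omega) (by omega)
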